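/- Let $d,N\ge 0$ be integers and $r\in\mathbb R$. Let $\mathcal S'(\mathbb R^d)$ be the space of real tempered distributions, $\mathcal M(\mathbb R^d)=\mathcal C_0(\mathbb R^d)^*$ the Banach space of Radon measures with the total variation norm (embedded in $\mathcal S'$), and $L_{\infty,-r}$ the space of (classes of) measurable functions $f:\mathbb R^d\to\mathbb R$ with $\operatorname{ess\,sup}_x |f(x)|(1+\|x\|)^{-r}<\infty$. Let $L:\mathcal S'(\mathbb R^d)\to\mathcal S'(\mathbb R^d)$ be a continuous linear operator and put $$\mathcal M_L(\mathbb R^d)=\{f\in L_{\infty,-r}: Lf\in\mathcal M(\mathbb R^d)\},\qquad \ker L=\{f\in L_{\infty,-r}: Lf=0\}.$$ Assume that $L$ is spline-admissible: 1. $L$ commutes with translations; 2. there is a generalized spline $\rho_L\in L_{\infty,-r}$ with $L\rho_L=\delta_0$; 3. $\ker L$ is finite-dimensional, with basis $p_1,\dots,p_N$; 4. (stability of the Green kernel) for some $\rho_L$ as in 2, there are functions $q_n:\mathbb R^d\to\mathbb R$ and a constant $C$ such that for every $y$, $\bigl|\rho_L(x-y)-\sum_{n=1}^N p_n(x)q_n(y)\bigr|\le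 C(1+\|x\|)^r$ for almost every $x$. Let $\phi_1,\dots,\phi_N$ be linear functionals on $\mathcal M_L(\mathbb R^d)$ with $\phi_n(p_m)=\delta_{nm}$, and give $\mathcal M_L(\mathbb R^d)$ the norm $\|f\|=\|Lf\|_{TV}+\|f\|_K$, $\|f\|_K=\bigl(\sum_n\phi_n(f)^2\bigr)^{1/2}$. For a closed complement $V$ of $\ker L$ and a complement $W$ of $\operatorname{ran}L$ in $\mathcal M(\mathbb R^d)$, let $L^+=j_V(L|_V)^{-1}\Pi_{\operatorname{ran}L}:\mathcal M(\mathbb R^d)\to\mathcal M_L(\mathbb R^d)$ be the pseudoinverse, where $\Pi_{\operatorname{ran}L}$ is the projection onto $\operatorname{ran}L$ along $W$ and $j_V$ is the inclusion of $V$. For functionals $\phi=(\phi_n)$ in $\mathcal M_L^*$ let $\mathcal C_L=\mathcal C_{L,\phi}=L^*(\mathcal C_0(\mathbb R^d))+\operatorname{span}(\phi_n)_{n=1}^N\subseteq \mathcal M_L(\mathbb R^d)^*$, where $\langle L^*\rho,f\rangle=\int\rho\,d(Lf)$. Then: * $\mathcal M_L(\mathbb R^d)$ is a Banach space, and $L:\mathcal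 M_L(\mathbb R^d)\to\mathcal M(\mathbb R^d)$ is Fredholm with $\operatorname{ran}L=\mathcal M(\mathbb R^d)$. In particular $\ker L$ has a closed complement, and $\operatorname{ran} L$ is closed and has a closed complement. The space $V_\phi=\bigcap_n\ker\phi_n$ is a closed complement of $\ker L$. * For $V=V_\phi$ the operator $L^+$ is continuous, and for every $a\in\mathcal M_L(\mathbb R^d)^*$, $$(L^+)^*a\in\mathcal C_0(\mathbb R^d)\iff a\in\mathcal C_L(\mathbb R^d),$$ where $(L^+)^*a\in\mathcal C_0$ means that there is $\rho\in\mathcal C_0(\mathbb R^d)$ with $\langle a,L^+\mu\rangle=\int\rho\,d\mu$ for all $\mu\in\mathcal M(\mathbb R^d)$. The same holds for every closed complement $V$ of $\ker L$, with $\mathcal C_L=\mathcal C_{L,\phi'}$ for any bounded functionals $\phi'_1,\dots,\phi'_N$ that vanish on $V$ and restrict to a basis of the dual of $\ker L$. -/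

import Mathlib

open scoped SchwartzMap ZeroAtInfty ContDiff
open MeasureTheory

namespace SplineNative

noncomputable section

/-- The Euclidean space `ℝ^d`. -/
abbrev RSpace (d : ℕ) : Type := EuclideanSpace ℝ (Fin d)

/-- Real tempered distributions on `ℝ^d`, with the weak-* topology. -/
abbrev Tempered (d : ℕ) : Type := 𝓢(RSpace d, ℝ) →Lₚₜ[ℝ] ℝ

/-- The Banach space `C₀(ℝ^d)` of continuous functions vanishing at infinity, with the sup norm.
This is a synonym of Mathlib's space, with the same instances. -/
def CZero (d : ℕ) : Type := C₀(RSpace d, ℝ)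

instance (d : ℕ) : FunLike (CZero d) (RSpace d) ℝ :=
  inferInstanceAs (FunLike C₀(RSpace d, ℝ) (RSpace d) ℝ)

instance (d : ℕ) : NormedAddCommGroup (CZero d) :=
  inferInstanceAs (NormedAddCommGroup C₀(RSpace d, ℝ))

instance (d : ℕ) : NormedSpace ℝ (CZero d) := inferInstanceAs (NormedSpace ℝ C₀(RSpace d, ℝ))

/-- Radon measures on `ℝ^d`: the Banach space dual of `C₀(ℝ^d)`. Its operator norm is the total
variation norm, and `μ ρ` is the integral of `ρ` against `μ`. -/
abbrev Radon (d : ℕ) : Type := StrongDual ℝ (CZero d)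

/-- Schwartz functions, as elements of `C₀(ℝ^d)`. -/
def schwartzToC0 (d : ℕ) : 𝓢(RSpace d, ℝ) →L[ℝ] CZero d :=
  SchwartzMap.toZeroAtInftyCLM ℝ (RSpace d) ℝ

/-- The Dirac mass at `x`, as a functional on `C₀(ℝ^d)`. -/
def dirac {d : ℕ} (x : RSpace d) : Radon d :=
  LinearMap.mkContinuous
    { toFun := fun f : CZero d => f x
      map_add' := fun _ _ => rfl
      map_smul' := fun _ _ => rfl } 1
    fun f => by
      rw [one_mul]
      exact BoundedContinuousFunction.norm_coe_le_norm (ZeroAtInftyContinuousMap.toBCF f) x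

@[simp] theorem dirac_apply {d : ℕ} (x : RSpace d) (f : CZero d) : dirac x f = f x := rfl

/-- The tempered distribution `ψ ↦ ∫ ψ dμ` attached to a Radon measure `μ`. -/
def measureToTempered (d : ℕ) : Radon d →ₗ[ℝ] Tempered d where
  toFun μ := ContinuousLinearMap.toPointwiseConvergenceCLM ℝ (RingHom.id ℝ) 𝓢(RSpace d, ℝ) ℝ
    (μ.comp (schwartzToC0 d))
  map_add' _ _ := rfl
  map_smul' _ _ := rfl

@[simp] theorem measureToTempered_apply {d : ℕ} (μ : Radon d) (ψ : 𝓢(RSpace d, ℝ)) :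
    measureToTempered d μ ψ = μ (schwartzToC0 d ψ) := rfl

theorem dense_schwartz (d : ℕ) :
    DenseRange (schwartzToC0 d) := by
  change DenseRange (SchwartzMap.toZeroAtInftyCLM ℝ (RSpace d) ℝ)
  intro f
  rw [Metric.mem_closure_iff]
  intro ε hε
  -- a continuous compactly supported function which is uniformly close to `f`
  let c : ℝ → ℝ := fun t => t - max (-(ε / 4)) (min t (ε / 4))
  have hc : Continuous c := by fun_prop
  have hcd : ∀ t, |c t - t| ≤ ε / 4 := by
    intro t
    have h1 : -(ε / 4) ≤ max (-(ε / 4)) (min t (ε / 4)) := le_max_left _ _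
    have h2 : max (-(ε / 4)) (min t (ε / 4)) ≤ ε / 4 :=
      max_le (by linarith) (min_le_right _ _)
    rw [abs_le]
    constructor <;> simp only [c] <;> linarith
  have hc0 : ∀ t, |t| < ε / 4 → c t = 0 := by
    intro t ht
    rw [abs_lt] at ht
    simp only [c]
    rw [min_eq_left ht.2.le, max_eq_right ht.1.le, sub_self]
  have hcs : HasCompactSupport (fun x => c (f x)) := by
    have h0 := f.zero_at_infty'
    have h1 : ∀ᶠ x in Filter.cocompact (RSpace d), |f x| < ε / 4 := by
      have := (Metric.tendsto_nhds.1 h0) (ε / 4) (by linarith)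
      filter_upwards [this] with x hx
      rw [Real.dist_eq, sub_zero] at hx
      exact hx
    obtain ⟨K, hK, hK'⟩ := Filter.mem_cocompact.1 h1
    refine HasCompactSupport.intro hK fun x hx => hc0 _ (hK' hx)
  obtain ⟨g, hg, hgd, hgs⟩ := (hc.comp f.continuous).exists_contDiff_approx (n := ⊤)
    (ε := fun _ => ε / 4) continuous_const (fun _ => by linarith)
  have hgc : HasCompactSupport g := hcs.mono hgs
  refine ⟨_, ⟨hgc.toSchwartzMap hg, rfl⟩, ?_⟩
  rw [← ZeroAtInftyContinuousMap.dist_toBCF_eq_dist]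
  refine lt_of_le_of_lt ((BoundedContinuousFunction.dist_le (C := ε / 2) (by linarith)).2 ?_)
    (by linarith)
  intro x
  have h1 := hgd x
  have h2 := hcd (f x)
  rw [Real.dist_eq] at h1
  change dist (f x) (g x) ≤ _
  rw [Real.dist_eq, abs_le]
  rw [abs_lt] at h1
  rw [abs_le] at h2
  change -(ε / 4) < g x - c (f x) ∧ g x - c (f x) < ε / 4 at h1
  constructor <;> linarith [h1.1, h1.2, h2.1, h2.2]

/-- A Radon measure is determined by its tempered distribution. -/
theorem measureToTempered_injective (d : ℕ) : Function.Injective (measureToTempered d) := by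
  intro μ ν h
  have h1 : (μ : CZero d → ℝ) = ν := by
    refine (dense_schwartz d).equalizer μ.continuous ν.continuous ?_
    funext ψ
    exact DFunLike.congr_fun h ψ
  exact DFunLike.coe_injective h1

/-- Translation of distributions, `τ_y u = u(· - y)`. -/
def translate {d : ℕ} (y : RSpace d) : Tempered d →L[ℝ] Tempered d :=
  PointwiseConvergenceCLM.precomp ℝ (SchwartzMap.compSubConstCLM ℝ (-y))

/-- `u` is a function `f` with `|f(x)| ≤ C (1 + ‖x‖)^r` for almost every `x`. -/
def GrowthBound {d : ℕ} (r C : ℝ) (u : Tempered d) : Prop :=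
  ∃ f : RSpace d → ℝ, AEStronglyMeasurable f volume ∧
    (∀ᵐ x ∂(volume : Measure (RSpace d)), |f x| ≤ C * (1 + ‖x‖) ^ r) ∧
    ∀ ψ : 𝓢(RSpace d, ℝ), u ψ = ∫ x, f x * ψ x

theorem integrable_mul_schwartz {d : ℕ} {r C : ℝ} {f : RSpace d → ℝ}
    (hf : AEStronglyMeasurable f volume)
    (hb : ∀ᵐ x ∂(volume : Measure (RSpace d)), |f x| ≤ C * (1 + ‖x‖) ^ r)
    (ψ : 𝓢(RSpace d, ℝ)) : Integrable (fun x => f x * ψ x) volume := by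
  obtain ⟨k, hk⟩ := exists_nat_ge r
  have h0 : Integrable (fun x => ‖x‖ ^ k * ‖ψ x‖) (volume : Measure (RSpace d)) :=
    ψ.integrable_pow_mul volume k
  have h1 : Integrable (fun x => ‖ψ x‖) (volume : Measure (RSpace d)) := ψ.integrable.norm
  have h2 : Integrable (fun x : RSpace d => |C| * 2 ^ k * (‖ψ x‖ + ‖x‖ ^ k * ‖ψ x‖)) volume :=
    (h1.add h0).const_mul _
  refine h2.mono' (hf.mul ψ.continuous.aestronglyMeasurable) ?_
  filter_upwards [hb] with x hx
  have hx1 : (1 : ℝ) ≤ 1 + ‖x‖ := by linarith [norm_nonneg x]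
  have e1 : (1 + ‖x‖) ^ r ≤ (1 + ‖x‖) ^ k := by
    rw [← Real.rpow_natCast]
    exact Real.rpow_le_rpow_of_exponent_le hx1 hk
  have e2 : (1 + ‖x‖) ^ k ≤ 2 ^ k * (1 + ‖x‖ ^ k) := by
    rcases le_total ‖x‖ 1 with h | h
    · calc (1 + ‖x‖) ^ k ≤ 2 ^ k := by gcongr; linarith
        _ ≤ 2 ^ k * (1 + ‖x‖ ^ k) := le_mul_of_one_le_right (by positivity) (by
            linarith [pow_nonneg (norm_nonneg x) k])
    · calc (1 + ‖x‖) ^ k ≤ (2 * ‖x‖) ^ k := by gcongr; linarith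
        _ = 2 ^ k * ‖x‖ ^ k := mul_pow _ _ _
        _ ≤ 2 ^ k * (1 + ‖x‖ ^ k) := by gcongr; linarith
  have e3 : |f x| ≤ |C| * (2 ^ k * (1 + ‖x‖ ^ k)) :=
    hx.trans (mul_le_mul (le_abs_self C) (e1.trans e2) (by positivity) (abs_nonneg C))
  rw [norm_mul, Real.norm_eq_abs (f x)]
  calc |f x| * ‖ψ x‖ ≤ |C| * (2 ^ k * (1 + ‖x‖ ^ k)) * ‖ψ x‖ := by gcongr
    _ = |C| * 2 ^ k * (‖ψ x‖ + ‖x‖ ^ k * ‖ψ x‖) := by ring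

/-- The distributions which are functions `f` obeying the growth estimate
`ess sup |f(x)| (1 + ‖x‖)^(-r) < ∞`. -/
def growthSpace (d : ℕ) (r : ℝ) : Submodule ℝ (Tempered d) where
  carrier := {u | ∃ C, GrowthBound r C u}
  zero_mem' := ⟨0, 0, aestronglyMeasurable_const, by simp, fun ψ => by simp⟩
  add_mem' := by
    rintro u v ⟨C, f, hf, hfb, hfu⟩ ⟨D, g, hg, hgb, hgv⟩
    refine ⟨C + D, f + g, hf.add hg, ?_, fun ψ => ?_⟩
    · filter_upwards [hfb, hgb] with x h1 h2
      calc |(f + g) x| ≤ |f x| + |g x| := abs_add_le _ _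
        _ ≤ (C + D) * (1 + ‖x‖) ^ r := by rw [add_mul]; exact add_le_add h1 h2
    · have h1 := integrable_mul_schwartz hf hfb ψ
      have h2 := integrable_mul_schwartz hg hgb ψ
      change u ψ + v ψ = _
      rw [hfu, hgv, ← integral_add h1 h2]
      simp only [Pi.add_apply, add_mul]
  smul_mem' := by
    rintro c u ⟨C, f, hf, hfb, hfu⟩
    refine ⟨|c| * C, c • f, hf.const_smul c, ?_, fun ψ => ?_⟩
    · filter_upwards [hfb] with x h1
      calc |(c • f) x| = |c| * |f x| := by simp [abs_mul]
        _ ≤ |c| * C * (1 + ‖x‖) ^ r := by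
            rw [mul_assoc]; exact mul_le_mul_of_nonneg_left h1 (abs_nonneg c)
    · change c • u ψ = _
      rw [hfu, ← integral_smul]
      simp only [Pi.smul_apply, smul_eq_mul, mul_assoc]

/-- The native space `M_L(ℝ^d)` as a vector space: the functions `f` obeying the growth estimate
of order `r` with `L f` a Radon measure. -/
def nativeSubmodule {d : ℕ} (L : Tempered d →L[ℝ] Tempered d) (r : ℝ) :
    Submodule ℝ (Tempered d) :=
  growthSpace d r ⊓ (LinearMap.range (measureToTempered d)).comap (L : Tempered d →ₗ[ℝ] Tempered d)

/-- The operator `L : M_L(ℝ^d) → M(ℝ^d)`. -/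
def measureOf {d : ℕ} (L : Tempered d →L[ℝ] Tempered d) (r : ℝ) :
    nativeSubmodule L r →ₗ[ℝ] Radon d :=
  (LinearEquiv.ofInjective (measureToTempered d) (measureToTempered_injective d)).symm.toLinearMap
    ∘ₗ (L : Tempered d →ₗ[ℝ] Tempered d).restrict (p := nativeSubmodule L r)
      (q := LinearMap.range (measureToTempered d)) (fun _ hu => hu.2)

theorem measureToTempered_measureOf {d : ℕ} (L : Tempered d →L[ℝ] Tempered d) (r : ℝ)
    (u : nativeSubmodule L r) : measureToTempered d (measureOf L r u) = L u :=
  congrArg Subtype.val ((LinearEquiv.ofInjective (measureToTempered d)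
    (measureToTempered_injective d)).apply_symm_apply ⟨L u, u.2.2⟩)

/-- Spline-admissible operators, with growth exponent `r`. -/
structure SplineAdmissible {d : ℕ} (L : Tempered d →L[ℝ] Tempered d) (r : ℝ) : Prop where
  shift_invariant : ∀ (y : RSpace d) (u : Tempered d), L (translate y u) = translate y (L u)
  exists_spline : ∃ ρ ∈ growthSpace d r, L ρ = measureToTempered d (dirac 0)
  finite_ker : FiniteDimensional ℝ (LinearMap.ker (measureOf L r))

/-- Stability of the Green kernel: for a generalized spline `ρ`, and after subtraction of a suitable
element `k_y` of the growth-restricted kernel of `L`, the function `g(·, y) = ρ(· - y) - k_y` is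
bounded by `C (1 + ‖x‖)^r` with a constant `C` that does not depend on `y`. In a basis `p_n` of the
kernel, `g(x, y) = ρ(x - y) - ∑ₙ p_n(x) q_n(y)`. -/
def StableKernel {d : ℕ} (L : Tempered d →L[ℝ] Tempered d) (r : ℝ) : Prop :=
  ∃ ρ ∈ growthSpace d r, L ρ = measureToTempered d (dirac 0) ∧
    ∃ C : ℝ, ∀ y : RSpace d, ∃ k ∈ growthSpace d r, L k = 0 ∧ GrowthBound r C (translate y ρ - k)

/-- A basis `p` of the growth-restricted kernel of `L`, together with linear functionals `φ` on
`M_L(ℝ^d)` that restrict to the dual basis. -/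
structure BiorthogonalSystem {d : ℕ} (L : Tempered d →L[ℝ] Tempered d) (r : ℝ) (N : ℕ) where
  p : Module.Basis (Fin N) ℝ (LinearMap.ker (measureOf L r))
  φ : Fin N → nativeSubmodule L r →ₗ[ℝ] ℝ
  biorthogonal : ∀ n m, φ n (p m) = if n = m then 1 else 0

namespace BiorthogonalSystem

variable {d N : ℕ} {L : Tempered d →L[ℝ] Tempered d} {r : ℝ}

/-- The native space `M_L(ℝ^d)`, to be normed through the biorthogonal system. -/
def Native (_ : BiorthogonalSystem L r N) : Type := nativeSubmodule L r

variable (S : BiorthogonalSystem L r N)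

instance : AddCommGroup S.Native := inferInstanceAs (AddCommGroup (nativeSubmodule L r))

instance : Module ℝ S.Native := inferInstanceAs (Module ℝ (nativeSubmodule L r))

/-- `L` as a linear map on the native space. -/
def opₗ : S.Native →ₗ[ℝ] Radon d := measureOf L r

/-- The vector `(φ_1(u), …, φ_N(u))`. -/
def coeffs : S.Native →ₗ[ℝ] EuclideanSpace ℝ (Fin N) :=
  (WithLp.linearEquiv 2 ℝ (Fin N → ℝ)).symm.toLinearMap ∘ₗ LinearMap.pi S.φ

theorem eq_zero_of_coeffs {u : S.Native} (h : S.opₗ u = 0) (h' : S.coeffs u = 0) : u = 0 := by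
  have hu : (S.p.repr ⟨u, h⟩) = 0 := by
    ext n
    have h1 : S.φ n u = 0 := congrFun (congrArg WithLp.ofLp h') n
    have h2 : (u : nativeSubmodule L r) =
        ∑ m, S.p.repr ⟨u, h⟩ m • (S.p m : nativeSubmodule L r) := by
      have := congrArg (LinearMap.ker (measureOf L r)).subtype (S.p.sum_repr ⟨u, h⟩)
      rw [map_sum] at this
      exact this.symm
    have h3 : S.φ n u = S.p.repr ⟨u, h⟩ n := by
      conv_lhs => rw [h2]
      simp [map_sum, S.biorthogonal]
    rw [← h3, h1]; rfl
  have h4 := S.p.repr.map_eq_zero_iff.1 hu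
  exact congrArg Subtype.val h4

/-- `‖u‖ = ‖L u‖_TV + ‖u‖_K`, with the semi-norm `‖u‖_K = (∑ₙ φ_n(u)²)^(1/2)`. -/
instance : Norm S.Native := ⟨fun u => ‖S.opₗ u‖ + ‖S.coeffs u‖⟩

theorem norm_def (u : S.Native) : ‖u‖ = ‖S.opₗ u‖ + ‖S.coeffs u‖ := rfl

theorem normCore : NormedSpace.Core ℝ S.Native where
  norm_nonneg u := by rw [norm_def]; positivity
  norm_smul c u := by
    have h1 : ‖S.opₗ (c • u)‖ = ‖c‖ * ‖S.opₗ u‖ := by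
      rw [map_smul, norm_smul]
    have h2 : ‖S.coeffs (c • u)‖ = ‖c‖ * ‖S.coeffs u‖ := by
      rw [map_smul, norm_smul]
    rw [norm_def, norm_def, h1, h2, mul_add]
  norm_triangle u v := by
    simp only [norm_def, map_add]
    linarith [norm_add_le (S.opₗ u) (S.opₗ v), norm_add_le (S.coeffs u) (S.coeffs v)]
  norm_eq_zero_iff u := by
    constructor
    · intro h
      rw [norm_def] at h
      have h1 := norm_nonneg (S.opₗ u)
      have h2 := norm_nonneg (S.coeffs u)
      have h3 : ‖S.opₗ u‖ = 0 := by linarith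
      have h4 : ‖S.coeffs u‖ = 0 := by linarith
      exact S.eq_zero_of_coeffs (norm_eq_zero.1 h3) (norm_eq_zero.1 h4)
    · rintro rfl
      simp [norm_def]

instance : NormedAddCommGroup S.Native := NormedAddCommGroup.ofCore S.normCore

instance : NormedSpace ℝ S.Native := NormedSpace.ofCore S.normCore

/-- The bounded operator `L : M_L(ℝ^d) → M(ℝ^d)`. -/
def op : S.Native →L[ℝ] Radon d :=
  S.opₗ.mkContinuous 1 fun u => by
    have h1 := S.norm_def u
    have h2 := norm_nonneg (S.coeffs u)
    linarith

/-- The functionals `φ_n`, as bounded functionals on the native space. -/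
def functional (n : Fin N) : StrongDual ℝ S.Native :=
  LinearMap.mkContinuous (S.φ n : S.Native →ₗ[ℝ] ℝ) 1 fun u => by
    have h1 := S.norm_def u
    have h2 : ‖S.φ n u‖ ≤ ‖S.coeffs u‖ := PiLp.norm_apply_le (S.coeffs u) n
    have h3 := norm_nonneg (S.opₗ u)
    refine h2.trans ?_
    linarith

/-- The space `V` of all `u` with `φ_n(u) = 0` for all `n`. -/
def complement : Submodule ℝ S.Native := ⨅ n, (S.functional n).ker

end BiorthogonalSystem

section General

variable {B : Type*} [NormedAddCommGroup B] [NormedSpace ℝ B] {d : ℕ}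

/-- The structural assumptions on `T`: its kernel has a closed complement, its range is closed
and has a closed complement. -/
def StructuralAssumptions (T : B →L[ℝ] Radon d) : Prop :=
  (∃ V : Submodule ℝ B, IsClosed (V : Set B) ∧ IsCompl T.ker V) ∧
    IsClosed (T.range : Set (Radon d)) ∧
    ∃ W : Submodule ℝ (Radon d), IsClosed (W : Set (Radon d)) ∧ IsCompl T.range W

/-- The pseudoinverse `T⁺ = j_V (T|_V)⁻¹ Π_{ran T}`, where `V` is a complement of `ker T` and
`Π_{ran T}` is the projection onto `ran T` along the complement `W`. -/
def pseudoInverse (T : B →L[ℝ] Radon d) {V : Submodule ℝ B} {W : Submodule ℝ (Radon d)}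
    (hV : IsCompl T.ker V) (hW : IsCompl T.range W) : Radon d →ₗ[ℝ] B :=
  V.subtype ∘ₗ
    (LinearMap.kerComplementEquivRange (T : B →ₗ[ℝ] Radon d) hV.symm).symm.toLinearMap ∘ₗ
      Submodule.projectionOnto T.range W hW

/-- The adjoint of `T` on `C₀(ℝ^d) ⊆ M(ℝ^d)^*`: `⟨T^* ρ, u⟩ = ∫ ρ d(T u)`. -/
def adjointOnC0 (T : B →L[ℝ] Radon d) : CZero d →ₗ[ℝ] StrongDual ℝ B where
  toFun ρ := (NormedSpace.inclusionInDoubleDual ℝ (CZero d) ρ).comp T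
  map_add' ρ σ := by ext; simp
  map_smul' c ρ := by ext; simp

@[simp] theorem adjointOnC0_apply (T : B →L[ℝ] Radon d) (ρ : CZero d) (u : B) :
    adjointOnC0 T ρ u = T u ρ := rfl

/-- `C_T = T^*(C₀(ℝ^d)) + span (φ_n)`, a subspace of the dual of `B`. -/
def predual (T : B →L[ℝ] Radon d) {N : ℕ} (φ : Fin N → StrongDual ℝ B) :
    Submodule ℝ (StrongDual ℝ B) :=
  LinearMap.range (adjointOnC0 T) ⊔ Submodule.span ℝ (Set.range φ)

/-- `(T⁺)^* a ∈ C₀(ℝ^d)`: there is `ρ ∈ C₀(ℝ^d)` with `⟨a, T⁺ μ⟩ = ∫ ρ dμ` for all `μ`. -/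
def PullbackInC0 (P : Radon d →ₗ[ℝ] B) (a : StrongDual ℝ B) : Prop :=
  ∃ ρ : CZero d, ∀ μ : Radon d, a (P μ) = μ ρ

end General

end

end SplineNative

namespace SplineNative

noncomputable section

/-! Everything rests on the surjectivity of `L`, which is obtained by compactness rather than by
integrating the Green kernel against a measure. Let `K` be the set of functions bounded by `C (1 +
‖x‖)^r`. After division by a power of `1 + ‖x‖²` these become functionals on `L²` dominated by a
fixed `L²` weight, so `K` is convex and, by Banach–Alaoglu, weak-* compact in the tempered
distributions (`isCompact_setOf_growthBound`). Stability of the kernel and translation invariance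
put every `± δ_y` into the compact convex set `L(K)`. By Hahn–Banach separation such a set contains
every measure of total variation at most one (`measureToTempered_mem`). No regularity in `y` of the
correction terms is used.

Given surjectivity, `u ↦ (L u, φ(u))` is an isometry of the native space onto an `ℓ¹` product of
Banach spaces, and the kernel is finite-dimensional, so `L` is Fredholm. The pseudoinverse inverts
`L` on `V` and is continuous by the closed graph theorem. Finally `a ∘ L⁺ = ρ` says that `a - L^* ρ`
vanishes on `V`, that is, lies in the span of the functionals dual to the kernel
(`pullbackInC0_iff_mem_predual`). -/

/-! ### Weights, and tempered distributions coming from `L²` -/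

theorem exists_memLp_weight (d : ℕ) (r : ℝ) :
    ∃ k : ℝ, MemLp (fun x : RSpace d => (1 + ‖x‖) ^ r * (1 + ‖x‖ ^ 2) ^ (-k)) 2 volume := by
  -- After squaring, `|r| / 2` cancels the growth of `(1 + ‖x‖)^r`, and `(d + 1) / 4` leaves the
  -- integrable function `(1 + ‖x‖²)^(-(d + 1) / 2)`.
  refine ⟨|r| / 2 + (d + 1) / 4, ?_⟩
  have hm : Measurable
      (fun x : RSpace d => (1 + ‖x‖) ^ r * (1 + ‖x‖ ^ 2) ^ (-(|r| / 2 + ((d : ℝ) + 1) / 4))) := by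
    fun_prop
  rw [memLp_two_iff_integrable_sq hm.aestronglyMeasurable]
  have h0 : Integrable (fun x : RSpace d => ((1 : ℝ) + ‖x‖ ^ 2) ^ (-((d : ℝ) + 1) / 2)) volume :=
    integrable_rpow_neg_one_add_norm_sq (by simp)
  refine (h0.const_mul ((2 : ℝ) ^ |r|)).mono' (hm.pow_const 2).aestronglyMeasurable
    (.of_forall fun x => ?_)
  have hx := norm_nonneg x
  have ha : 0 < 1 + ‖x‖ ^ 2 := by positivity
  have h1 : (1 + ‖x‖) ^ r ≤ (2 * (1 + ‖x‖ ^ 2)) ^ (|r| / 2) := by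
    calc (1 + ‖x‖) ^ r ≤ (1 + ‖x‖) ^ |r| :=
          Real.rpow_le_rpow_of_exponent_le (by linarith) (le_abs_self r)
      _ = ((1 + ‖x‖) ^ 2) ^ (|r| / 2) := by
          rw [← Real.rpow_natCast, ← Real.rpow_mul (by positivity)]
          congr 1
          push_cast
          ring
      _ ≤ _ := by
          gcongr
          nlinarith [sq_nonneg (1 - ‖x‖)]
  rw [Real.norm_of_nonneg (by positivity)]
  calc ((1 + ‖x‖) ^ r * (1 + ‖x‖ ^ 2) ^ (-(|r| / 2 + ((d : ℝ) + 1) / 4))) ^ 2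
      ≤ ((2 * (1 + ‖x‖ ^ 2)) ^ (|r| / 2) *
          (1 + ‖x‖ ^ 2) ^ (-(|r| / 2 + ((d : ℝ) + 1) / 4))) ^ 2 := by gcongr
    _ = 2 ^ |r| * (1 + ‖x‖ ^ 2) ^ (-((d : ℝ) + 1) / 2) := by
      rw [Real.mul_rpow (by norm_num) ha.le, mul_assoc, ← Real.rpow_add ha, mul_pow,
        ← Real.rpow_natCast, ← Real.rpow_natCast, ← Real.rpow_mul (by norm_num),
        ← Real.rpow_mul ha.le]
      congr 2 <;> push_cast <;> ring

/-- Multiplication of Schwartz functions by `(1 + ‖x‖²)^k`, with values in `L²`. -/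
def weightedToL2 (d : ℕ) (k : ℝ) : 𝓢(RSpace d, ℝ) →L[ℝ] Lp ℝ 2 (volume : Measure (RSpace d)) :=
  (SchwartzMap.toLpCLM ℝ ℝ 2 volume).comp
    (SchwartzMap.smulLeftCLM ℝ fun x : RSpace d => (1 + ‖x‖ ^ 2) ^ k)

theorem coeFn_weightedToL2 {d : ℕ} (k : ℝ) (ψ : 𝓢(RSpace d, ℝ)) :
    weightedToL2 d k ψ =ᵐ[volume] fun x => (1 + ‖x‖ ^ 2) ^ k * ψ x := by
  filter_upwards [SchwartzMap.coeFn_toLp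
    (SchwartzMap.smulLeftCLM ℝ (fun x : RSpace d => (1 + ‖x‖ ^ 2) ^ k) ψ) 2 volume] with x hx
  refine hx.trans ?_
  rw [SchwartzMap.smulLeftCLM_apply_apply (Function.hasTemperateGrowth_one_add_norm_sq_rpow _ _)]
  rfl

/-- The distribution `ψ ↦ ℓ((1 + ‖x‖²)^k ψ)` attached to a functional `ℓ` on `L²`. -/
def l2DualToTempered (d : ℕ) (k : ℝ) :
    WeakDual ℝ (Lp ℝ 2 (volume : Measure (RSpace d))) →ₗ[ℝ] Tempered d where
  toFun ℓ := ContinuousLinearMap.toPointwiseConvergenceCLM ℝ (RingHom.id ℝ) 𝓢(RSpace d, ℝ) ℝ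
    ((WeakDual.toStrongDual ℓ).comp (weightedToL2 d k))
  map_add' _ _ := rfl
  map_smul' _ _ := rfl

@[simp] theorem l2DualToTempered_apply {d : ℕ} (k : ℝ)
    (ℓ : WeakDual ℝ (Lp ℝ 2 (volume : Measure (RSpace d)))) (ψ : 𝓢(RSpace d, ℝ)) :
    l2DualToTempered d k ℓ ψ = ℓ (weightedToL2 d k ψ) := rfl

theorem continuous_l2DualToTempered (d : ℕ) (k : ℝ) : Continuous (l2DualToTempered d k) :=
  PointwiseConvergenceCLM.continuous_of_continuous_eval fun _ => WeakDual.eval_continuous _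

/-! ### Dominated functionals on `L²` -/

/-- The functionals on `L²` dominated by integration against `C g`. -/
def dominatedDual {α : Type*} [MeasurableSpace α] (μ : Measure α) (g : α → ℝ) (C : ℝ) :
    Set (WeakDual ℝ (Lp ℝ 2 μ)) :=
  {ℓ | ∀ h : Lp ℝ 2 μ, |ℓ h| ≤ C * ∫ x, g x * |h x| ∂μ}

section Dominated

variable {α : Type*} [MeasurableSpace α] {μ : Measure α} {g : α → ℝ}

theorem convex_dominatedDual (C : ℝ) : Convex ℝ (dominatedDual μ g C) := by
  intro ℓ hℓ ℓ' hℓ' a b ha hb hab h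
  calc |(a • ℓ + b • ℓ') h| = |a * ℓ h + b * ℓ' h| := rfl
    _ ≤ a * |ℓ h| + b * |ℓ' h| := by
      refine (abs_add_le _ _).trans ?_
      rw [abs_mul, abs_mul, abs_of_nonneg ha, abs_of_nonneg hb]
    _ ≤ a * (C * ∫ x, g x * |h x| ∂μ) + b * (C * ∫ x, g x * |h x| ∂μ) :=
      add_le_add (mul_le_mul_of_nonneg_left (hℓ h) ha) (mul_le_mul_of_nonneg_left (hℓ' h) hb)
    _ = C * ∫ x, g x * |h x| ∂μ := by rw [← add_mul, hab, one_mul]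

theorem integral_mul_abs_le (hg : MemLp g 2 μ) (h : Lp ℝ 2 μ) :
    |∫ x, g x * |h x| ∂μ| ≤ ‖hg.toLp g‖ * ‖h‖ := by
  have h1 : ∫ x, g x * |h x| ∂μ = inner ℝ (|h|) (hg.toLp g) := by
    rw [L2.inner_def]
    refine integral_congr_ae ?_
    filter_upwards [hg.coeFn_toLp, Lp.coeFn_abs h] with x h1 h2
    rw [h1, h2]
    rfl
  rw [h1]
  refine (abs_real_inner_le_norm _ _).trans_eq ?_
  rw [mul_comm, norm_abs_eq_norm]

/-- Banach–Alaoglu: Cauchy–Schwarz bounds the operator norms by `|C| ‖g‖`, and the domination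
inequality for each fixed `h` is a weak-* closed condition. -/
theorem isCompact_dominatedDual (hg : MemLp g 2 μ) (C : ℝ) :
    IsCompact (dominatedDual μ g C) := by
  refine WeakDual.isCompact_of_bounded_of_closed ?_ ?_
  · refine (isBounded_iff_forall_norm_le (E := StrongDual ℝ (Lp ℝ 2 μ))).2
      ⟨|C| * ‖hg.toLp g‖, fun ℓ hℓ => ?_⟩
    refine ContinuousLinearMap.opNorm_le_bound _ (by positivity) fun h => ?_
    refine (hℓ h).trans ((le_abs_self _).trans ?_)
    rw [abs_mul, mul_assoc]
    exact mul_le_mul_of_nonneg_left (integral_mul_abs_le hg h) (abs_nonneg C)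
  · rw [dominatedDual, Set.ofPred_forall]
    exact isClosed_iInter fun h =>
      isClosed_le (WeakDual.eval_continuous h).abs continuous_const

theorem ae_le_of_forall_setIntegral_le_of_memLp [SigmaFinite μ] {f : α → ℝ}
    (hf : MemLp f 2 μ) (hg : MemLp g 2 μ)
    (h : ∀ s, MeasurableSet s → μ s < ⊤ → ∫ x in s, f x ∂μ ≤ ∫ x in s, g x ∂μ) :
    f ≤ᵐ[μ] g := by
  have hi : ∀ {f : α → ℝ}, MemLp f 2 μ → ∀ s, MeasurableSet s → μ s < ⊤ → IntegrableOn f s μ :=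
    fun hf s _ hs' => by
      have : IsFiniteMeasure (μ.restrict s) := ⟨by simpa using hs'⟩
      exact (hf.restrict s).integrable (by norm_num)
  have := ae_nonneg_of_forall_setIntegral_nonneg_of_sigmaFinite (f := g - f)
    (fun s hs hs' => (hi hg s hs hs').sub (hi hf s hs hs')) fun s hs hs' => by
      simp only [Pi.sub_apply]
      rw [integral_sub (hi hg s hs hs') (hi hf s hs hs')]
      exact sub_nonneg.2 (h s hs hs')
  filter_upwards [this] with x hx
  exact sub_nonneg.1 hx

/-- The function `F` is the Riesz representative; testing on indicators of sets of finite measure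
turns domination into the pointwise bound. -/
theorem exists_of_mem_dominatedDual [SigmaFinite μ] (hg : MemLp g 2 μ) {C : ℝ}
    {ℓ : WeakDual ℝ (Lp ℝ 2 μ)} (hℓ : ℓ ∈ dominatedDual μ g C) :
    ∃ F : Lp ℝ 2 μ, (∀ᵐ x ∂μ, |F x| ≤ C * g x) ∧ ∀ h : Lp ℝ 2 μ, ℓ h = ∫ x, F x * h x ∂μ := by
  obtain ⟨F, hF⟩ := (InnerProductSpace.toDual ℝ (Lp ℝ 2 μ)).surjective (WeakDual.toStrongDual ℓ)
  have hF' : ∀ h : Lp ℝ 2 μ, ℓ h = inner ℝ F h := fun h => by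
    rw [← InnerProductSpace.toDual_apply_apply, hF]
    rfl
  refine ⟨F, ?_, fun h => ?_⟩
  · have key : ∀ s, MeasurableSet s → μ s < ⊤ →
        |∫ x in s, F x ∂μ| ≤ ∫ x in s, C * g x ∂μ := fun s hs hs' => by
      have h1 := hℓ (indicatorConstLp 2 hs hs'.ne (1 : ℝ))
      rw [hF', real_inner_comm, L2.inner_indicatorConstLp_one] at h1
      refine h1.trans_eq ?_
      rw [integral_const_mul, ← integral_indicator hs]
      congr 1
      refine integral_congr_ae ?_
      filter_upwards [indicatorConstLp_coeFn (p := 2) (hs := hs) (hμs := hs'.ne) (c := (1 : ℝ))]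
        with x hx
      rw [hx]
      by_cases hxs : x ∈ s <;> simp [hxs]
    have h1 := ae_le_of_forall_setIntegral_le_of_memLp (Lp.memLp F) (hg.const_mul C)
      fun s hs hs' => (le_abs_self _).trans (key s hs hs')
    have h2 := ae_le_of_forall_setIntegral_le_of_memLp (Lp.memLp F).neg (hg.const_mul C)
      fun s hs hs' => by
        simp only [Pi.neg_apply]
        rw [integral_neg]
        exact (neg_le_abs _).trans (key s hs hs')
    filter_upwards [h1, h2] with x h1 h2
    exact abs_le'.2 ⟨h1, h2⟩
  · rw [hF', L2.inner_def]
    refine integral_congr_ae (.of_forall fun x => ?_)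
    exact mul_comm _ _

end Dominated

/-! ### Weak-* compactness and convexity of the growth balls -/

/-- The factor `(1 + ‖x‖²)^(-k)` carries a function of the growth ball into `L²`, and `(1 + ‖x‖²)^k`
carries a Riesz representative back. -/
theorem growthBound_iff_mem_image_dominatedDual {d : ℕ} {r k : ℝ}
    (hk : MemLp (fun x : RSpace d => (1 + ‖x‖) ^ r * (1 + ‖x‖ ^ 2) ^ (-k)) 2 volume) (C : ℝ)
    (u : Tempered d) :
    GrowthBound r C u ↔ u ∈ l2DualToTempered d k ''
      dominatedDual volume (fun x : RSpace d => (1 + ‖x‖) ^ r * (1 + ‖x‖ ^ 2) ^ (-k)) C := by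
  have hcancel : ∀ x : RSpace d, (1 + ‖x‖ ^ 2) ^ (-k) * (1 + ‖x‖ ^ 2) ^ k = (1 : ℝ) := fun x => by
    rw [← Real.rpow_add (by positivity), neg_add_cancel, Real.rpow_zero]
  have hpos : ∀ (x : RSpace d) (k : ℝ), (0 : ℝ) ≤ (1 + ‖x‖ ^ 2) ^ k := fun x k => by positivity
  have hmeas : ∀ k : ℝ, Measurable fun x : RSpace d => (1 + ‖x‖ ^ 2) ^ k := fun k => by fun_prop
  constructor
  · rintro ⟨f, hf, hfb, hfu⟩
    have hbound : ∀ᵐ x ∂(volume : Measure (RSpace d)),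
        |f x * (1 + ‖x‖ ^ 2) ^ (-k)| ≤ C * ((1 + ‖x‖) ^ r * (1 + ‖x‖ ^ 2) ^ (-k)) := by
      filter_upwards [hfb] with x hx
      rw [abs_mul, abs_of_nonneg (hpos x _), ← mul_assoc]
      exact mul_le_mul_of_nonneg_right hx (hpos x _)
    have hF : MemLp (fun x => f x * (1 + ‖x‖ ^ 2) ^ (-k)) 2 volume :=
      (hk.const_mul C).mono' (hf.mul (hmeas _).aestronglyMeasurable) hbound
    refine ⟨StrongDual.toWeakDual (InnerProductSpace.toDual ℝ _ (hF.toLp _)), ?_, ?_⟩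
    · intro h
      change |inner ℝ (hF.toLp _) h| ≤ _
      rw [L2.inner_def, ← integral_const_mul]
      refine abs_integral_le_integral_abs.trans (integral_mono_ae ?_ ?_ ?_)
      · exact (L2.integrable_inner _ _).abs
      · exact (hk.integrable_mul (Lp.memLp h).abs).const_mul C
      · filter_upwards [hbound, hF.coeFn_toLp] with x h1 h2
        change |h x * hF.toLp _ x| ≤ _
        rw [h2, mul_comm, abs_mul, ← mul_assoc C]
        exact mul_le_mul_of_nonneg_right h1 (abs_nonneg _)
    · ext ψ
      change inner ℝ (hF.toLp _) (weightedToL2 d k ψ) = _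
      rw [hfu, L2.inner_def]
      refine integral_congr_ae ?_
      filter_upwards [hF.coeFn_toLp, coeFn_weightedToL2 k ψ] with x h1 h2
      change weightedToL2 d k ψ x * hF.toLp _ x = _
      rw [h1, h2]
      linear_combination (f x * ψ x) * hcancel x
  · rintro ⟨ℓ, hℓ, rfl⟩
    obtain ⟨F, hFb, hF⟩ := exists_of_mem_dominatedDual hk hℓ
    refine ⟨fun x => F x * (1 + ‖x‖ ^ 2) ^ k,
      (Lp.aestronglyMeasurable F).mul (hmeas _).aestronglyMeasurable, ?_, fun ψ => ?_⟩
    · filter_upwards [hFb] with x hx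
      rw [abs_mul, abs_of_nonneg (hpos x _)]
      refine (mul_le_mul_of_nonneg_right hx (hpos x _)).trans_eq ?_
      linear_combination (C * (1 + ‖x‖) ^ r) * hcancel x
    · rw [l2DualToTempered_apply, hF]
      refine integral_congr_ae ?_
      filter_upwards [coeFn_weightedToL2 k ψ] with x hx
      rw [hx, mul_assoc]

theorem exists_setOf_growthBound_eq_image (d : ℕ) (r C : ℝ) :
    ∃ (k : ℝ) (g : RSpace d → ℝ), MemLp g 2 volume ∧
      {u : Tempered d | GrowthBound r C u} = l2DualToTempered d k '' dominatedDual volume g C := by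
  obtain ⟨k, hk⟩ := exists_memLp_weight d r
  exact ⟨k, _, hk, Set.ext (growthBound_iff_mem_image_dominatedDual hk C)⟩

theorem isCompact_setOf_growthBound (d : ℕ) (r C : ℝ) :
    IsCompact {u : Tempered d | GrowthBound r C u} := by
  obtain ⟨k, g, hg, h⟩ := exists_setOf_growthBound_eq_image d r C
  rw [h]
  exact (isCompact_dominatedDual hg C).image (continuous_l2DualToTempered d k)

theorem convex_setOf_growthBound (d : ℕ) (r C : ℝ) :
    Convex ℝ {u : Tempered d | GrowthBound r C u} := by
  obtain ⟨k, g, -, h⟩ := exists_setOf_growthBound_eq_image d r C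
  rw [h]
  exact (convex_dominatedDual C).linear_image (l2DualToTempered d k)

theorem GrowthBound.neg {d : ℕ} {r C : ℝ} {u : Tempered d} (hu : GrowthBound r C u) :
    GrowthBound r C (-u) := by
  obtain ⟨f, hf, hfb, hfu⟩ := hu
  refine ⟨-f, hf.neg, by simpa using hfb, fun ψ => ?_⟩
  change -(u ψ) = _
  rw [hfu, ← integral_neg]
  simp

/-! ### Separation, and surjectivity of `L` -/

theorem norm_le_of_forall_abs_le {d : ℕ} {f : CZero d} {M : ℝ} (hM : 0 ≤ M)
    (h : ∀ x, |f x| ≤ M) : ‖f‖ ≤ M :=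
  (BoundedContinuousFunction.norm_le (f := ZeroAtInftyContinuousMap.toBCF f) hM).2 h

/-- Weak-* closed convex sets are cut out by Schwartz functions. -/
theorem mem_of_forall_schwartz_le {d : ℕ} {A : Set (Tempered d)} (hA : Convex ℝ A)
    (hA' : IsCompact A) {v : Tempered d}
    (h : ∀ (ψ : 𝓢(RSpace d, ℝ)) (m : ℝ), (∀ u ∈ A, u ψ ≤ m) → v ψ ≤ m) : v ∈ A := by
  by_contra hv
  let e := PointwiseConvergenceCLM.equivWeakDual ℝ 𝓢(RSpace d, ℝ)
  have : LocallyConvexSpace ℝ (WeakDual ℝ 𝓢(RSpace d, ℝ)) :=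
    WeakBilin.locallyConvexSpace (B := topDualPairing ℝ 𝓢(RSpace d, ℝ))
  obtain ⟨F, m, hF, hm⟩ := geometric_hahn_banach_closed_point
    (hA.linear_image (e : Tempered d →ₗ[ℝ] WeakDual ℝ 𝓢(RSpace d, ℝ)))
    (hA'.image e.continuous).isClosed (x := e v) (by
      rintro ⟨u, hu, huv⟩
      exact hv (e.injective huv ▸ hu))
  -- A weak-* continuous functional is evaluation at a test function.
  obtain ⟨ψ, hψ⟩ := LinearMap.dualEmbedding_surjective (topDualPairing ℝ 𝓢(RSpace d, ℝ)) F
  have hF' : ∀ u : Tempered d, F (e u) = u ψ := fun u => by rw [← hψ]; rfl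
  have h1 := h ψ m fun u hu => by
    rw [← hF']
    exact (hF _ ⟨u, hu, rfl⟩).le
  rw [hF'] at hm
  exact absurd hm (not_lt.2 h1)

/-- A weak-* compact convex set of distributions that contains `± δ_y` for all `y` contains all
Radon measures of total variation at most one. -/
theorem measureToTempered_mem {d : ℕ} {A : Set (Tempered d)} (hA : Convex ℝ A)
    (hA' : IsCompact A) (hpos : ∀ y, measureToTempered d (dirac y) ∈ A)
    (hneg : ∀ y, -measureToTempered d (dirac y) ∈ A) {μ : Radon d} (hμ : ‖μ‖ ≤ 1) :
    measureToTempered d μ ∈ A := by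
  refine mem_of_forall_schwartz_le hA hA' fun ψ m hm => ?_
  -- Testing the half-space on `± δ_y` bounds the sup norm of `ψ` by `m`.
  have h1 : ∀ y, |schwartzToC0 d ψ y| ≤ m := fun y =>
    abs_le'.2 ⟨hm _ (hpos y), hm _ (hneg y)⟩
  have h2 : ‖schwartzToC0 d ψ‖ ≤ m :=
    norm_le_of_forall_abs_le ((abs_nonneg _).trans (h1 0)) h1
  calc μ (schwartzToC0 d ψ) ≤ ‖μ (schwartzToC0 d ψ)‖ := Real.le_norm_self _
    _ ≤ 1 * ‖schwartzToC0 d ψ‖ := μ.le_of_opNorm_le hμ _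
    _ ≤ m := by rwa [one_mul]

theorem translate_dirac_zero {d : ℕ} (y : RSpace d) :
    translate y (measureToTempered d (dirac 0)) = measureToTempered d (dirac y) := by
  ext ψ
  change ψ (0 - -y) = ψ y
  simp

theorem exists_growthSpace_eq_measure {d : ℕ} {r : ℝ} {L : Tempered d →L[ℝ] Tempered d}
    (hL : SplineAdmissible L r) (hS : StableKernel L r) (μ : Radon d) :
    ∃ u ∈ growthSpace d r, L u = measureToTempered d μ := by
  obtain ⟨ρ, -, hρ, C, hC⟩ := hS
  have hδ : ∀ y, ∃ u, GrowthBound r C u ∧ L u = measureToTempered d (dirac y) := fun y => by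
    obtain ⟨k, -, hk, hb⟩ := hC y
    refine ⟨_, hb, ?_⟩
    rw [map_sub, hk, sub_zero, hL.shift_invariant, hρ, translate_dirac_zero]
  have hball : ∀ ν : Radon d, ‖ν‖ ≤ 1 →
      measureToTempered d ν ∈ L '' {u : Tempered d | GrowthBound r C u} := fun ν hν => by
    refine measureToTempered_mem
      ((convex_setOf_growthBound d r C).linear_image (L : Tempered d →ₗ[ℝ] Tempered d))
      ((isCompact_setOf_growthBound d r C).image L.continuous)
      (fun y => ?_) (fun y => ?_) hν
    · exact hδ y
    · obtain ⟨u, hu, hu'⟩ := hδ y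
      exact ⟨-u, hu.neg, (map_neg L u).trans (congrArg _ hu')⟩
  -- Scaling by `1 + ‖μ‖` instead of `‖μ‖` covers `μ = 0`.
  obtain ⟨u, hu, hu'⟩ := hball ((1 + ‖μ‖)⁻¹ • μ) (by
    rw [norm_smul, Real.norm_of_nonneg (by positivity), inv_mul_le_iff₀ (by positivity)]
    linarith)
  refine ⟨(1 + ‖μ‖) • u, (growthSpace d r).smul_mem _ ⟨C, hu⟩, ?_⟩
  rw [map_smul, hu', map_smul, smul_inv_smul₀ (by positivity)]

/-! ### The native space as a Banach space -/

namespace BiorthogonalSystem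

variable {d N : ℕ} {L : Tempered d →L[ℝ] Tempered d} {r : ℝ} (S : BiorthogonalSystem L r N)

theorem op_surjective (hL : SplineAdmissible L r) (hS : StableKernel L r) :
    Function.Surjective S.op := fun μ => by
  obtain ⟨u, hu, hu'⟩ := exists_growthSpace_eq_measure hL hS μ
  refine ⟨(⟨u, hu, μ, hu'.symm⟩ : nativeSubmodule L r), measureToTempered_injective d ?_⟩
  exact (measureToTempered_measureOf L r _).trans hu'

/-- The basis `p` of the kernel of `L`. -/
def kerBasis : Module.Basis (Fin N) ℝ S.op.ker := S.p

theorem functional_kerBasis (n m : Fin N) :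
    S.functional n (S.kerBasis m) = if n = m then 1 else 0 := S.biorthogonal n m

theorem functional_sum_kerBasis (c : Fin N → ℝ) (n : Fin N) :
    S.functional n (∑ m, c m • (S.kerBasis m : S.Native)) = c n := by
  simp [map_sum, functional_kerBasis]

theorem finiteDimensional_ker : FiniteDimensional ℝ S.op.ker :=
  S.kerBasis.finiteDimensional_of_finite

theorem mem_complement {u : S.Native} : u ∈ S.complement ↔ ∀ n, S.functional n u = 0 := by
  simp [complement]

theorem isClosed_complement : IsClosed (S.complement : Set S.Native) := by
  rw [complement, Submodule.coe_iInf]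
  exact isClosed_iInter fun n => (S.functional n).isClosed_ker

theorem isCompl_complement : IsCompl S.op.ker S.complement := by
  refine IsCompl.of_eq ?_ ?_
  · refine (Submodule.eq_bot_iff _).2 fun u ⟨hu, hu'⟩ => S.eq_zero_of_coeffs hu ?_
    ext n
    exact S.mem_complement.1 hu' n
  · refine Submodule.eq_top_iff'.2 fun u => Submodule.mem_sup.2
      ⟨∑ m, S.functional m u • (S.kerBasis m : S.Native), ?_,
        u - ∑ m, S.functional m u • (S.kerBasis m : S.Native), ?_, by abel⟩
    · exact Submodule.sum_mem _ fun m _ => Submodule.smul_mem _ _ (S.kerBasis m).2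
    · rw [mem_complement]
      intro n
      rw [map_sub, functional_sum_kerBasis, sub_self]

/-- The map `u ↦ (L u, (φ_n(u))_n)`. -/
def opCoeffs : S.Native →ₗ[ℝ] WithLp 1 (Radon d × EuclideanSpace ℝ (Fin N)) :=
  (WithLp.linearEquiv 1 ℝ _).symm.toLinearMap ∘ₗ S.opₗ.prod S.coeffs

theorem norm_opCoeffs (u : S.Native) : ‖S.opCoeffs u‖ = ‖u‖ := by
  rw [WithLp.prod_norm_eq_of_L1, norm_def]
  rfl

theorem opCoeffs_surjective (h : Function.Surjective S.op) :
    Function.Surjective S.opCoeffs := fun x => by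
  obtain ⟨u, hu⟩ := h x.fst
  -- A kernel element corrects the coefficients of `u` without changing `L u`.
  let v := ∑ m, (x.snd m - S.functional m u) • (S.kerBasis m : S.Native)
  have hv : S.op v = 0 :=
    Submodule.sum_mem S.op.ker fun m _ => Submodule.smul_mem _ _ (S.kerBasis m).2
  refine ⟨u + v, (WithLp.linearEquiv 1 ℝ _).injective (Prod.ext ?_ ?_)⟩
  · change S.op (u + v) = x.fst
    rw [map_add, hv, hu, add_zero]
  · ext n
    change S.functional n (u + v) = x.snd n
    rw [map_add, functional_sum_kerBasis]
    ring

theorem completeSpace (h : Function.Surjective S.op) : CompleteSpace S.Native :=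
  let e : S.Native ≃ₗᵢ[ℝ] WithLp 1 (Radon d × EuclideanSpace ℝ (Fin N)) :=
    LinearIsometryEquiv.ofSurjective ⟨S.opCoeffs, S.norm_opCoeffs⟩ (S.opCoeffs_surjective h)
  e.toIsometryEquiv.completeSpace

end BiorthogonalSystem

/-! ### Pseudoinverses of surjective operators -/

section General

variable {B : Type*} [NormedAddCommGroup B] [NormedSpace ℝ B] {d : ℕ} {T : B →L[ℝ] Radon d}
  {V : Submodule ℝ B} {W : Submodule ℝ (Radon d)}

theorem pseudoInverse_mem (hV : IsCompl T.ker V) (hW : IsCompl T.range W) (μ : Radon d) :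
    pseudoInverse T hV hW μ ∈ V :=
  Subtype.property _

/-- Since the range is everything, the projection along `W` is the identity. -/
theorem apply_pseudoInverse (hT : Function.Surjective T) (hV : IsCompl T.ker V)
    (hW : IsCompl T.range W) (μ : Radon d) : T (pseudoInverse T hV hW μ) = μ := by
  have h1 := congrArg Subtype.val ((LinearMap.kerComplementEquivRange (T : B →ₗ[ℝ] Radon d)
    hV.symm).apply_symm_apply (Submodule.projectionOnto T.range W hW μ))
  refine Eq.trans h1 ?_
  exact congrArg Subtype.val
    (Submodule.projectionOnto_apply_left hW ⟨μ, LinearMap.mem_range.2 (hT μ)⟩)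

theorem eq_pseudoInverse (hT : Function.Surjective T) (hV : IsCompl T.ker V)
    (hW : IsCompl T.range W) {v : B} (hv : v ∈ V) : pseudoInverse T hV hW (T v) = v := by
  have h1 : pseudoInverse T hV hW (T v) - v ∈ T.ker := by
    rw [LinearMap.mem_ker]
    change T _ = 0
    rw [map_sub, apply_pseudoInverse hT, sub_self]
  exact sub_eq_zero.1 ((Submodule.disjoint_def.1 hV.disjoint) _ h1
    (V.sub_mem (pseudoInverse_mem hV hW _) hv))

/-- Closed graph theorem: the graph consists of the pairs `(μ, u)` with `u ∈ V` and `T u = μ`, two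
closed conditions. -/
theorem continuous_pseudoInverse [CompleteSpace B] (hT : Function.Surjective T)
    (hVc : IsClosed (V : Set B)) (hV : IsCompl T.ker V) (hW : IsCompl T.range W) :
    Continuous (pseudoInverse T hV hW) := by
  refine LinearMap.continuous_of_isClosed_graph _ ?_
  have : ((pseudoInverse T hV hW).graph : Set (Radon d × B)) =
      {x | x.2 ∈ (V : Set B)} ∩ {x | T x.2 = x.1} := by
    ext ⟨μ, u⟩
    constructor
    · intro h
      obtain rfl : u = pseudoInverse T hV hW μ := h
      exact ⟨pseudoInverse_mem hV hW μ, apply_pseudoInverse hT hV hW μ⟩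
    · rintro ⟨h1, rfl : T u = μ⟩
      exact (eq_pseudoInverse hT hV hW h1).symm
  rw [this]
  exact (hVc.preimage continuous_snd).inter
    (isClosed_eq (T.continuous.comp continuous_snd) continuous_fst)

/-- Both `b` and `∑ n, b (q n) • φ n` vanish on `V` and agree on the basis `q` of the kernel, so
they are equal. -/
theorem mem_span_of_vanish {N : ℕ} (hV : IsCompl T.ker V) (q : Module.Basis (Fin N) ℝ T.ker)
    {φ : Fin N → StrongDual ℝ B} (hφ : ∀ n m, φ n (q m) = if n = m then 1 else 0)
    (hφV : ∀ n, ∀ v ∈ V, φ n v = 0) {b : StrongDual ℝ B} (hb : ∀ v ∈ V, b v = 0) :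
    b ∈ Submodule.span ℝ (Set.range φ) := by
  have key : b = ∑ n, b (q n) • φ n := by
    ext u
    obtain ⟨k, hk, v, hv, rfl⟩ := Submodule.mem_sup.1 (hV.sup_eq_top ▸ Submodule.mem_top (x := u))
    have h2 : (b.toLinearMap ∘ₗ T.ker.subtype) =
        ((∑ n, b (q n) • φ n : StrongDual ℝ B).toLinearMap ∘ₗ T.ker.subtype) := by
      refine q.ext fun m => ?_
      simp [hφ]
    have h3 : b k = (∑ n, b (q n) • φ n : StrongDual ℝ B) k := LinearMap.congr_fun h2 ⟨k, hk⟩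
    rw [map_add, map_add, hb v hv, h3]
    simp [hφV _ v hv]
  rw [key]
  exact Submodule.sum_mem _ fun n _ => Submodule.smul_mem _ _ (Submodule.subset_span ⟨n, rfl⟩)

/-- The same `ρ` serves on both sides: evaluating at `μ = T v` with `v ∈ V` shows that `a - T^* ρ`
vanishes on `V`; conversely the span of the `φ n` is invisible on the range of `T⁺`, which lies in
`V`. -/
theorem pullbackInC0_iff_mem_predual {N : ℕ} (hT : Function.Surjective T) (hV : IsCompl T.ker V)
    (hW : IsCompl T.range W) (q : Module.Basis (Fin N) ℝ T.ker) {φ : Fin N → StrongDual ℝ B}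
    (hφ : ∀ n m, φ n (q m) = if n = m then 1 else 0) (hφV : ∀ n, ∀ v ∈ V, φ n v = 0)
    (a : StrongDual ℝ B) :
    PullbackInC0 (pseudoInverse T hV hW) a ↔ a ∈ predual T φ := by
  constructor
  · rintro ⟨ρ, hρ⟩
    refine Submodule.mem_sup.2 ⟨adjointOnC0 T ρ, ⟨ρ, rfl⟩, a - adjointOnC0 T ρ, ?_, by abel⟩
    refine mem_span_of_vanish hV q hφ hφV fun v hv => ?_
    have := hρ (T v)
    rw [eq_pseudoInverse hT hV hW hv] at this
    rw [sub_apply, adjointOnC0_apply, this, sub_self]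
  · intro ha
    obtain ⟨_, ⟨ρ, rfl⟩, b, hb, rfl⟩ := Submodule.mem_sup.1 ha
    refine ⟨ρ, fun μ => ?_⟩
    have hb' : b (pseudoInverse T hV hW μ) = 0 := by
      clear ha
      induction hb using Submodule.span_induction with
      | mem b hb =>
        obtain ⟨n, rfl⟩ := hb
        exact hφV n _ (pseudoInverse_mem hV hW μ)
      | zero => rfl
      | add b c _ _ hb hc => rw [add_apply, hb, hc, add_zero]
      | smul t b _ hb => rw [smul_apply, hb, smul_zero]
    rw [add_apply, adjointOnC0_apply, apply_pseudoInverse hT, hb', add_zero]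

theorem isFredholm_of_surjective [CompleteSpace B] (hT : Function.Surjective T)
    (hk : FiniteDimensional ℝ T.ker) : T.IsFredholm where
  -- Open mapping theorem, which needs `B` complete.
  isStrictMap := (T.isOpenMap hT).isQuotientMap T.continuous hT |>.isStrictMap
  isClosed_range := by
    rw [LinearMap.range_eq_top.2 hT]
    exact isClosed_univ
  finite_ker := hk
  finite_coker := by
    rw [LinearMap.range_eq_top.2 hT]
    infer_instance
  closedComplemented_ker := Submodule.ClosedComplemented.of_finiteDimensional _

end General

end

end SplineNative

theorem mainTheorem11 {d N : ℕ} (r : ℝ)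
    (L : SplineNative.Tempered d →L[ℝ] SplineNative.Tempered d)
    (hL : SplineNative.SplineAdmissible L r) (hS : SplineNative.StableKernel L r)
    (S : SplineNative.BiorthogonalSystem L r N) :
    -- the native space is a Banach space
    CompleteSpace S.Native ∧
    -- `L` is Fredholm, and onto
    S.op.IsFredholm ∧ S.op.range = ⊤ ∧
    SplineNative.StructuralAssumptions S.op ∧
    -- the common kernel of the functionals of the system is a closed complement of `ker L`
    (IsClosed (S.complement : Set S.Native) ∧ IsCompl S.op.ker S.complement) ∧
    -- for the complement and the functionals of the system
    (∀ (hV : IsCompl S.op.ker S.complement) (W : Submodule ℝ (SplineNative.Radon d))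
      (hW : IsCompl S.op.range W),
      Continuous (SplineNative.pseudoInverse S.op hV hW) ∧
      ∀ a : StrongDual ℝ S.Native,
        SplineNative.PullbackInC0 (SplineNative.pseudoInverse S.op hV hW) a ↔
          a ∈ SplineNative.predual S.op S.functional) ∧
    -- for an arbitrary closed complement `V` of `ker L`, and functionals which vanish on `V` and
    -- restrict to a basis of the dual of `ker L`
    (∀ (V : Submodule ℝ S.Native) (_ : IsClosed (V : Set S.Native)) (hV : IsCompl S.op.ker V)
      (W : Submodule ℝ (SplineNative.Radon d)) (hW : IsCompl S.op.range W)
      (q : Module.Basis (Fin N) ℝ S.op.ker) (φ : Fin N → StrongDual ℝ S.Native)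
      (_ : ∀ n m, φ n (q m) = if n = m then 1 else 0) (_ : ∀ n, ∀ v ∈ V, φ n v = 0),
      Continuous (SplineNative.pseudoInverse S.op hV hW) ∧
      ∀ a : StrongDual ℝ S.Native,
        SplineNative.PullbackInC0 (SplineNative.pseudoInverse S.op hV hW) a ↔
          a ∈ SplineNative.predual S.op φ) := by
  have hsurj := S.op_surjective hL hS
  have hrange : S.op.range = ⊤ := LinearMap.range_eq_top.2 hsurj
  have hcomplete := S.completeSpace hsurj
  refine ⟨hcomplete, SplineNative.isFredholm_of_surjective hsurj S.finiteDimensional_ker, hrange,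
    ⟨⟨_, S.isClosed_complement, S.isCompl_complement⟩, ?_, ⊥, ?_, ?_⟩,
    ⟨S.isClosed_complement, S.isCompl_complement⟩, fun hV W hW => ⟨?_, ?_⟩,
    fun V hVc hV W hW q φ hφ hφV => ⟨?_, ?_⟩⟩
  · rw [hrange]
    exact isClosed_univ
  · exact isClosed_singleton
  · rw [hrange]
    exact isCompl_top_bot
  · exact SplineNative.continuous_pseudoInverse hsurj S.isClosed_complement hV hW
  · exact SplineNative.pullbackInC0_iff_mem_predual hsurj hV hW S.kerBasis S.functional_kerBasis
      fun n v hv => S.mem_complement.1 hv n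
  · exact SplineNative.continuous_pseudoInverse hsurj hVc hV hW
  · exact SplineNative.pullbackInC0_iff_mem_predual hsurj hV hW q hφ hφV
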